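/- Let $k$ be a field. A \emph{pseudo-tensor category} over $k$ is an essentially small monoidal category $\mathbf{D}$ that is $k$-linear with $k$-linear tensor product, is additive and idempotent complete, in which every object has a left and a right dual, and for which $k\to\mathrm{End}(\mathbb{1})$ is an isomorphism. A \emph{tensor category} over $k$ is a pseudo-tensor category over $k$ that is abelian. For a pseudo-tensor category $\mathbf{D}$ and a tensor category $\mathbf{T}$ over $k$, a fully faithful $k$-linear (strong) monoidal functor $F:\mathbf{D}\to\mathbf{T}$ is an \emph{abelian envelope} of $\mathbf{D}$ if for every tensor category $\mathbf{T}_1$ over $k$, composition with $F$ induces an equivalence from the category of exact $k$-linear monoidal functors $\mathbf{T}\to\mathbf{T}_1$ to the category of faithful $k$-linear monoidal functors $\mathbf{D}\to\mathbf{T}_1$, where the morphisms in both categories are the monoidal natural transformations. \textbf{Theorem.} A $k$-linear monoidal functor $F:\mathbf{T}_1\to\mathbf{T}_2$ between two tensor categories over $k$ is faithful if and only if it is exact. In other words, every tensor category $\mathbf{T}$ over $k$ is its own abelian envelope: the identity functor $\mathbf{T}\to\mathbf{T}$ is an abelian envelope of $\mathbf{T}$. -/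

import Mathlib

open CategoryTheory MonoidalCategory Limits

universe w v₁ v₂ v₃ u₁ u₂ u₃

/-- A `k`-linear monoidal category `D` (a monoidal category that is `k`-linear, with `k`-linear
tensor product) is a pseudo-tensor category over `k` if it is essentially small, the map
`k → End (𝟙_ D)` is an isomorphism, every object has a left and a right dual, and `D` is
pseudo-abelian, that is, additive and idempotent complete. -/
class IsPseudoTensorCategory (k : Type w) [Field k] (D : Type u₁) [Category.{v₁} D]
    [Preadditive D] [Linear k D] [MonoidalCategory D] [MonoidalPreadditive D]
    [MonoidalLinear k D] : Prop where
  essentiallySmall : EssentiallySmall.{v₁} D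
  bijective_algebraMap_end_unit : Function.Bijective (algebraMap k (End (𝟙_ D)))
  nonempty_hasLeftDual (X : D) : Nonempty (HasLeftDual X)
  nonempty_hasRightDual (X : D) : Nonempty (HasRightDual X)
  hasFiniteBiproducts : HasFiniteBiproducts D
  isIdempotentComplete : IsIdempotentComplete D

/-- A tensor category over `k` is a pseudo-tensor category over `k` whose underlying additive
category is abelian. -/
class IsTensorCategory (k : Type w) [Field k] (T : Type u₁) [Category.{v₁} T]
    [Abelian T] [Linear k T] [MonoidalCategory T] [MonoidalPreadditive T]
    [MonoidalLinear k T] : Prop extends IsPseudoTensorCategory k T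

section LinearMonoidalFunctor

variable (k : Type w) [Field k]
  (C : Type u₁) [Category.{v₁} C] [Preadditive C] [Linear k C] [MonoidalCategory C]
  (D : Type u₂) [Category.{v₂} D] [Preadditive D] [Linear k D] [MonoidalCategory D]
  (E : Type u₃) [Category.{v₃} E] [Preadditive E] [Linear k E] [MonoidalCategory E]

/-- `k`-linear (strong) monoidal functors. -/
structure LinearMonoidalFunctor where
  /-- the underlying functor -/
  functor : C ⥤ D
  /-- the monoidal structure -/
  monoidal : functor.Monoidal
  additive : functor.Additive
  linear : functor.Linear k

namespace LinearMonoidalFunctor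

attribute [instance] monoidal additive linear

variable {k C D E}

/-- A morphism of linear monoidal functors is a monoidal natural transformation. -/
@[ext]
structure Hom (G H : LinearMonoidalFunctor k C D) where
  /-- the underlying natural transformation -/
  natTrans : G.functor ⟶ H.functor
  isMonoidal : NatTrans.IsMonoidal natTrans

attribute [instance] Hom.isMonoidal

/-- The category of `k`-linear monoidal functors and monoidal natural transformations. -/
instance : Category (LinearMonoidalFunctor k C D) where
  Hom := Hom
  id G := ⟨𝟙 G.functor, inferInstance⟩
  comp α β := ⟨α.natTrans ≫ β.natTrans, inferInstance⟩
  id_comp α := Hom.ext (Category.id_comp α.natTrans)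
  comp_id α := Hom.ext (Category.comp_id α.natTrans)
  assoc α β γ := Hom.ext (Category.assoc α.natTrans β.natTrans γ.natTrans)

variable (k C D)

/-- The property of being faithful. -/
def isFaithful : ObjectProperty (LinearMonoidalFunctor k C D) :=
  fun G => G.functor.Faithful

/-- The property of being exact, that is, of preserving finite limits and finite colimits. -/
def isExact : ObjectProperty (LinearMonoidalFunctor k C D) :=
  fun G => exactFunctor C D G.functor

variable {k C D}

/-- Precomposition `G ↦ F ⋙ G` with a linear monoidal functor `F`, as a functor between
categories of linear monoidal functors and monoidal natural transformations. -/
def precomp (F : C ⥤ D) [F.Monoidal] [F.Additive] [F.Linear k] :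
    LinearMonoidalFunctor k D E ⥤ LinearMonoidalFunctor k C E where
  obj G := ⟨F ⋙ G.functor, inferInstance, inferInstance, inferInstance⟩
  map α := ⟨Functor.whiskerLeft F α.natTrans, inferInstance⟩
  map_id _ := Hom.ext (by rfl)
  map_comp _ _ := Hom.ext (by rfl)

end LinearMonoidalFunctor

end LinearMonoidalFunctor

open LinearMonoidalFunctor in
/-- Let `D` be a pseudo-tensor category and `T` a tensor category over `k`. A linear monoidal
functor `F : D ⥤ T` is an abelian envelope of `D` if it is fully faithful and, for each tensor
category `T₁` over `k`, composition with `F` induces an equivalence from the category of exact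
linear monoidal functors `T ⥤ T₁` to the category of faithful linear monoidal functors `D ⥤ T₁`
(the morphisms in both categories being all monoidal natural transformations).

The first clause of `equivalence` says that composition with `F` does map the former functors
to the latter. -/
structure IsAbelianEnvelope (k : Type w) [Field k]
    {D : Type u₁} [Category.{v₁} D] [Preadditive D] [Linear k D] [MonoidalCategory D]
    [MonoidalPreadditive D] [MonoidalLinear k D] [IsPseudoTensorCategory k D]
    {T : Type u₂} [Category.{v₂} T] [Abelian T] [Linear k T] [MonoidalCategory T]
    [MonoidalPreadditive T] [MonoidalLinear k T] [IsTensorCategory k T]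
    (F : D ⥤ T) [F.Monoidal] [F.Additive] [F.Linear k] : Prop where
  full : F.Full
  faithful : F.Faithful
  equivalence (T₁ : Type u₃) [Category.{v₃} T₁] [Abelian T₁] [Linear k T₁]
    [MonoidalCategory T₁] [MonoidalPreadditive T₁] [MonoidalLinear k T₁]
    [IsTensorCategory k T₁] :
    ∃ h : ∀ G : (isExact k T T₁).FullSubcategory, isFaithful k D T₁ ((precomp F).obj G.obj),
      ((isFaithful k D T₁).lift ((isExact k T T₁).ι ⋙ precomp F) h).IsEquivalence

/-! ### Rigid abelian categories: simplicity of the unit and splittings after tensoring -/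

section RigidAbelian

variable {C : Type u₁} [Category.{v₁} C] [Abelian C] [MonoidalCategory C] [MonoidalPreadditive C]

/-! Duals make tensoring exact; since nonzero endomorphisms of the unit are invertible, the unit is
then simple (`epi_of_ne_zero_unit`, `mono_of_ne_zero_unit`). Exact implies faithful: for `X`
nonzero, evaluation is an epimorphism from `Xᘁ ⊗ X` to the unit, so `F` kills no nonzero object,
hence no nonzero image. Faithful implies exact: `F` sends an epimorphism `p : P ⟶ 𝟙_ C` to a
nonzero, hence epic, map to the unit. Every epimorphism splits after tensoring its target with such
a `p` (`exists_epi_unit_lift`). The splitting survives `F`, and `exists_fac_of_epi_unit` descends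
factorizations along `F.map p`, so cokernels are preserved. The dual splitting handles
monomorphisms. The envelope statement follows because the two functor categories have the same
objects. -/

lemma isZero_of_evaluation_eq_zero (X Y : C) [ExactPairing X Y] (h : ε_ X Y = 0) : IsZero X := by
  have := ExactPairing.evaluation_coevaluation X Y
  rw [h, MonoidalPreadditive.whiskerLeft_zero, comp_zero, comp_zero] at this
  rw [IsZero.iff_id_eq_zero, ← cancel_epi (λ_ X).hom, ← cancel_mono (ρ_ X).inv]
  simp [← this]

lemma isZero_of_coevaluation_eq_zero (X Y : C) [ExactPairing X Y] (h : η_ X Y = 0) :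
    IsZero Y := by
  have := ExactPairing.coevaluation_evaluation X Y
  rw [h, MonoidalPreadditive.whiskerLeft_zero, zero_comp] at this
  rw [IsZero.iff_id_eq_zero, ← cancel_epi (ρ_ Y).hom, ← cancel_mono (λ_ Y).inv]
  simp [← this]

lemma isZero_tensor_of_isZero_left {X : C} (h : IsZero X) (Y : C) : IsZero (X ⊗ Y) :=
  (tensorRight Y).map_isZero h

lemma isZero_tensor_of_isZero_right (X : C) {Y : C} (h : IsZero Y) : IsZero (X ⊗ Y) :=
  (tensorLeft X).map_isZero h

variable [LeftRigidCategory C] [RightRigidCategory C]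

/-- The two duals of `X` provide adjoints of tensoring on both sides, whence its exactness. -/
instance (X : C) : (tensorLeft X).IsLeftAdjoint :=
  (tensorLeftAdjunction (ᘁX) X).isLeftAdjoint

instance (X : C) : (tensorLeft X).IsRightAdjoint :=
  (tensorLeftAdjunction X (Xᘁ)).isRightAdjoint

instance (X : C) : (tensorRight X).IsLeftAdjoint :=
  (tensorRightAdjunction X (Xᘁ)).isLeftAdjoint

instance (X : C) : (tensorRight X).IsRightAdjoint :=
  (tensorRightAdjunction (ᘁX) X).isRightAdjoint

instance (X : C) {Y Z : C} (f : Y ⟶ Z) [Epi f] : Epi (X ◁ f) :=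
  inferInstanceAs (Epi ((tensorLeft X).map f))

instance (X : C) {Y Z : C} (f : Y ⟶ Z) [Mono f] : Mono (X ◁ f) :=
  inferInstanceAs (Mono ((tensorLeft X).map f))

instance (X : C) {Y Z : C} (f : Y ⟶ Z) [Epi f] : Epi (f ▷ X) :=
  inferInstanceAs (Epi ((tensorRight X).map f))

instance (X : C) {Y Z : C} (f : Y ⟶ Z) [Mono f] : Mono (f ▷ X) :=
  inferInstanceAs (Mono ((tensorRight X).map f))

lemma CategoryTheory.ShortComplex.ShortExact.map_tensorLeft {S : ShortComplex C}
    (hS : S.ShortExact) (X : C) : (S.map (tensorLeft X)).ShortExact :=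
  hS.map_of_exact _

lemma CategoryTheory.ShortComplex.ShortExact.map_tensorRight {S : ShortComplex C}
    (hS : S.ShortExact) (X : C) : (S.map (tensorRight X)).ShortExact :=
  hS.map_of_exact _

/-- If `0 ⟶ U ⟶ 𝟙_ C ⟶ V ⟶ 0` is exact, then `U ⊗ V = 0`. -/
lemma isZero_tensor_of_shortExact_unit {U V : C} {i : U ⟶ 𝟙_ C} {q : 𝟙_ C ⟶ V} [Mono i] [Epi q]
    (w : i ≫ q = 0) : IsZero (U ⊗ V) := by
  have h : i ▷ V = 0 := by
    rw [← cancel_epi (U ◁ q), whisker_exchange, comp_zero]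
    have : i ▷ 𝟙_ C ≫ 𝟙_ C ◁ q = (ρ_ U).hom ≫ (i ≫ q) ≫ (λ_ V).inv := by
      simp [← unitors_inv_equal]
    rw [this, w, zero_comp, comp_zero]
  exact IsZero.of_mono_eq_zero _ h

lemma isZero_tensor_of_shortExact_unit' {U V : C} {i : U ⟶ 𝟙_ C} {q : 𝟙_ C ⟶ V} [Mono i] [Epi q]
    (w : i ≫ q = 0) : IsZero (V ⊗ U) := by
  have h : V ◁ i = 0 := by
    rw [← cancel_epi (q ▷ U), ← whisker_exchange, comp_zero]
    have : 𝟙_ C ◁ i ≫ q ▷ 𝟙_ C = (λ_ U).hom ≫ (i ≫ q) ≫ (ρ_ V).inv := by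
      simp [unitors_inv_equal]
    rw [this, w, zero_comp, comp_zero]
  exact IsZero.of_mono_eq_zero _ h

/-- If `0 ⟶ U ⟶ 𝟙_ C ⟶ V ⟶ 0` is exact, then there are no nonzero morphisms `V ⊗ X ⟶ U`. -/
lemma eq_zero_of_shortExact_unit {U V : C} {i : U ⟶ 𝟙_ C} {q : 𝟙_ C ⟶ V}
    {w : i ≫ q = 0} (hS : (ShortComplex.mk i q w).ShortExact) {X : C} (f : V ⊗ X ⟶ U) :
    f = 0 := by
  have := hS.mono_f
  have := hS.epi_g
  dsimp at *
  -- The image is a quotient of `V ⊗ X` and a subobject of `U`, so it is annihilated by both `U` and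
  -- `V`, hence by the unit.
  have h₁ : IsZero (U ⊗ Abelian.image f) :=
    IsZero.of_epi (U ◁ Abelian.factorThruImage f)
      (((isZero_tensor_of_isZero_left (isZero_tensor_of_shortExact_unit w) X)).of_iso
        (α_ U V X).symm)
  have h₂ : IsZero (V ⊗ Abelian.image f) :=
    IsZero.of_mono (V ◁ Abelian.image.ι f) (isZero_tensor_of_shortExact_unit' w)
  have h₃ : IsZero (𝟙_ C ⊗ Abelian.image f) :=
    (hS.map_tensorRight (Abelian.image f)).exact.isZero_of_both_zeros
      (h₁.eq_of_src _ _) (h₂.eq_of_tgt _ _)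
  have h₄ : IsZero (Abelian.image f) := h₃.of_iso (λ_ _).symm
  rw [← Abelian.image.fac f, h₄.eq_of_tgt (Abelian.factorThruImage f) 0, zero_comp]

/-- A nonzero quotient of the unit object admits a nonzero morphism to the unit object. -/
lemma exists_ne_zero_of_epi_unit {V : C} (q : 𝟙_ C ⟶ V) [Epi q] (hV : ¬ IsZero V) :
    ∃ r : V ⟶ 𝟙_ C, r ≠ 0 := by
  have hS : (ShortComplex.mk (kernel.ι q) q (kernel.condition q)).ShortExact :=
    { exact := ShortComplex.exact_kernel q }
  -- Maps `X ⟶ ᘁV ⊗ kernel q` correspond to maps `V ⊗ X ⟶ kernel q`, which all vanish.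
  have hU : IsZero ((ᘁV) ⊗ kernel q) := by
    rw [IsZero.iff_id_eq_zero]
    apply (tensorLeftHomEquiv _ (ᘁV) V _).symm.injective
    rw [eq_zero_of_shortExact_unit hS ((tensorLeftHomEquiv _ (ᘁV) V _).symm (𝟙 _)),
      eq_zero_of_shortExact_unit hS ((tensorLeftHomEquiv _ (ᘁV) V _).symm 0)]
  have : Mono ((ᘁV) ◁ q) :=
    (hS.map_tensorLeft (ᘁV)).exact.mono_g (hU.eq_of_src _ _)
  have : IsIso ((ᘁV) ◁ q) := isIso_of_mono_of_epi _
  -- The witness is the mate of the coevaluation, carried from `ᘁV ⊗ V` back to `ᘁV ⊗ 𝟙_ C`; it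
  -- vanishes only if the coevaluation does.
  refine ⟨(ρ_ V).inv ≫ (tensorLeftHomEquiv (𝟙_ C) (ᘁV) V (𝟙_ C)).symm (η_ (ᘁV) V ≫ inv ((ᘁV) ◁ q)),
    fun h ↦ hV (isZero_of_coevaluation_eq_zero (ᘁV) V ?_)⟩
  rw [← cancel_mono (inv ((ᘁV) ◁ q)), zero_comp]
  apply (tensorLeftHomEquiv (𝟙_ C) (ᘁV) V (𝟙_ C)).symm.injective
  rw [← cancel_epi (ρ_ V).inv, h]
  simp [tensorLeftHomEquiv]

/-- A nonzero cokernel would map nontrivially back to the unit. The composite endomorphism of the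
unit is invertible, so the cokernel projection is monic and `p = 0`. -/
lemma epi_of_ne_zero_unit (hend : ∀ f : 𝟙_ C ⟶ 𝟙_ C, f ≠ 0 → IsIso f)
    {X : C} (p : X ⟶ 𝟙_ C) (hp : p ≠ 0) : Epi p := by
  by_contra hepi
  have hq : cokernel.π p ≠ 0 := fun h ↦ hepi (Preadditive.epi_of_cokernel_zero h)
  obtain ⟨r, hr⟩ := exists_ne_zero_of_epi_unit (cokernel.π p) fun h ↦ hq (h.eq_of_tgt _ _)
  have := hend (cokernel.π p ≫ r) fun h ↦ hr (by rwa [← cancel_epi (cokernel.π p), comp_zero])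
  have : Mono (cokernel.π p) := mono_of_mono _ r
  exact hp (by rw [← cancel_mono (cokernel.π p), cokernel.condition, zero_comp])

lemma mono_of_ne_zero_unit (hend : ∀ f : 𝟙_ C ⟶ 𝟙_ C, f ≠ 0 → IsIso f)
    {X : C} (p : 𝟙_ C ⟶ X) (hp : p ≠ 0) : Mono p := by
  refine Preadditive.mono_of_kernel_zero ?_
  by_contra h
  have := epi_of_ne_zero_unit hend _ h
  exact hp (by rw [← cancel_epi (kernel.ι p), kernel.condition, comp_zero])

/-- An epimorphism to `Y` splits after tensoring `Y` with an epimorphism to the unit object. -/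
lemma exists_epi_unit_lift {X Y : C} (f : X ⟶ Y) [Epi f] :
    ∃ (P : C) (p : P ⟶ 𝟙_ C) (s : P ⊗ Y ⟶ X), Epi p ∧ s ≫ f = p ▷ Y ≫ (λ_ Y).hom := by
  -- A section of `f` amounts to a lift of the coevaluation through `f ▷ Yᘁ`; the pullback carries
  -- the universal such lift.
  refine ⟨pullback (f ▷ Yᘁ) (η_ Y (Yᘁ)), pullback.snd _ _,
    (tensorRightHomEquiv _ Y (Yᘁ) _).symm (pullback.fst _ _), inferInstance, ?_⟩
  apply (tensorRightHomEquiv _ Y (Yᘁ) _).injective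
  rw [tensorRightHomEquiv_naturality, Equiv.apply_symm_apply, pullback.condition,
    ← Equiv.symm_apply_eq, tensorRightHomEquiv_symm_naturality]
  congr 1
  simp [tensorRightHomEquiv]

/-- A monomorphism from `X` splits after tensoring `X` with a monomorphism from the unit object. -/
lemma exists_mono_unit_extension {X Y : C} (f : X ⟶ Y) [Mono f] :
    ∃ (P : C) (i : 𝟙_ C ⟶ P) (r : Y ⟶ P ⊗ X), Mono i ∧ f ≫ r = (λ_ X).inv ≫ i ▷ X := by
  refine ⟨pushout (f ▷ ᘁX) (ε_ (ᘁX) X), pushout.inr _ _,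
    tensorRightHomEquiv _ (ᘁX) X _ (pushout.inl _ _), inferInstance, ?_⟩
  apply (tensorRightHomEquiv _ (ᘁX) X _).symm.injective
  rw [tensorRightHomEquiv_symm_naturality, Equiv.symm_apply_apply, pushout.condition,
    Equiv.eq_symm_apply, tensorRightHomEquiv_naturality]
  congr 1
  simp [tensorRightHomEquiv]

end RigidAbelian

/-! ### Descent of factorizations along an epimorphism to the unit -/

section Descent

variable {C : Type u₁} [Category.{v₁} C] [Abelian C] [MonoidalCategory C] [MonoidalPreadditive C]
  [LeftRigidCategory C] [RightRigidCategory C]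

/-- Descent along an epimorphism to the unit object: if `f` is an epimorphism, a morphism
factors through `f` as soon as it does so after tensoring with `p : P ⟶ 𝟙_ C`. -/
lemma exists_fac_of_epi_unit {P X Y Z : C} (p : P ⟶ 𝟙_ C) [Epi p] (f : X ⟶ Y) [Epi f]
    (g : X ⟶ Z) (h : P ⊗ Y ⟶ Z) (w : P ◁ f ≫ h = p ▷ X ≫ (λ_ X).hom ≫ g) :
    ∃ g' : Y ⟶ Z, f ≫ g' = g := by
  have hS : (ShortComplex.mk (kernel.ι p) p (kernel.condition p)).ShortExact :=
    { exact := ShortComplex.exact_kernel p }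
  have hS' := hS.map_tensorRight Y
  -- Vanishing may be tested after the epimorphism `kernel p ◁ f`, where `w` brings in `kernel.ι p ≫
  -- p = 0`.
  have hker : kernel.ι p ▷ Y ≫ h = 0 := by
    rw [← cancel_epi (kernel p ◁ f), whisker_exchange_assoc, w, ← comp_whiskerRight_assoc,
      kernel.condition, MonoidalPreadditive.zero_whiskerRight, zero_comp, comp_zero]
  have := hS'.epi_g
  obtain ⟨k, hk⟩ : ∃ k : 𝟙_ C ⊗ Y ⟶ Z, p ▷ Y ≫ k = h :=
    ⟨hS'.exact.desc h hker, hS'.exact.g_desc h hker⟩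
  refine ⟨(λ_ Y).inv ≫ k, ?_⟩
  rw [← cancel_epi (λ_ X).hom, ← cancel_epi (p ▷ X), ← w, ← hk, whisker_exchange_assoc]
  simp

end Descent

/-! ### Faithfulness versus exactness of monoidal functors -/

section Functor

open Functor.LaxMonoidal Functor.OplaxMonoidal

section

variable {C : Type u₁} [Category.{v₁} C] [Abelian C] [MonoidalCategory C]
  {D : Type u₂} [Category.{v₂} D] [Abelian D] [MonoidalCategory D] [MonoidalPreadditive D]
  [LeftRigidCategory D] [RightRigidCategory D]
  (F : C ⥤ D) [F.Monoidal]

lemma epi_map_comp_η_of_faithful [F.Faithful] [F.Additive]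
    (hD : ∀ f : 𝟙_ D ⟶ 𝟙_ D, f ≠ 0 → IsIso f) (hC : ¬ IsZero (𝟙_ C)) {P : C} (p : P ⟶ 𝟙_ C)
    [Epi p] : Epi (F.map p ≫ η F) := by
  refine epi_of_ne_zero_unit hD _ fun h ↦ hC ?_
  rw [← zero_comp, cancel_mono] at h
  exact IsZero.of_epi_eq_zero p (F.zero_of_map_zero _ h)

lemma mono_ε_comp_map_of_faithful [F.Faithful] [F.Additive]
    (hD : ∀ f : 𝟙_ D ⟶ 𝟙_ D, f ≠ 0 → IsIso f) (hC : ¬ IsZero (𝟙_ C)) {P : C} (i : 𝟙_ C ⟶ P)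
    [Mono i] : Mono (ε F ≫ F.map i) := by
  refine mono_of_ne_zero_unit hD _ fun h ↦ hC ?_
  rw [← comp_zero (f := ε F), cancel_epi] at h
  exact IsZero.of_mono_eq_zero i (F.zero_of_map_zero _ h)

end

section

variable {C : Type u₁} [Category.{v₁} C] [Abelian C] [MonoidalCategory C] [MonoidalPreadditive C]
  [LeftRigidCategory C] [RightRigidCategory C]
  {D : Type u₂} [Category.{v₂} D] [Abelian D] [MonoidalCategory D] [MonoidalPreadditive D]
  [LeftRigidCategory D] [RightRigidCategory D]
  (F : C ⥤ D) [F.Monoidal]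

lemma preservesEpimorphisms_of_faithful [F.Faithful] [F.Additive]
    (hD : ∀ f : 𝟙_ D ⟶ 𝟙_ D, f ≠ 0 → IsIso f) (hC : ¬ IsZero (𝟙_ C)) :
    F.PreservesEpimorphisms where
  preserves {X Y} f _ := by
    obtain ⟨P, p, s, _, hs⟩ := exists_epi_unit_lift f
    have := epi_map_comp_η_of_faithful F hD hC p
    have h : (F.map p ≫ η F) ▷ F.obj Y ≫ (λ_ _).hom = μ F P Y ≫ F.map s ≫ F.map f := by
      rw [← F.map_comp, hs]
      simp
    have : Epi (μ F P Y ≫ F.map s ≫ F.map f) := h ▸ inferInstance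
    rw [← Category.assoc] at this
    exact epi_of_epi (μ F P Y ≫ F.map s) _

lemma preservesMonomorphisms_of_faithful [F.Faithful] [F.Additive]
    (hD : ∀ f : 𝟙_ D ⟶ 𝟙_ D, f ≠ 0 → IsIso f) (hC : ¬ IsZero (𝟙_ C)) :
    F.PreservesMonomorphisms where
  preserves {X Y} f _ := by
    obtain ⟨P, i, r, _, hr⟩ := exists_mono_unit_extension f
    have := mono_ε_comp_map_of_faithful F hD hC i
    have h : (λ_ _).inv ≫ (ε F ≫ F.map i) ▷ F.obj X = F.map f ≫ F.map r ≫ δ F P X := by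
      rw [← F.map_comp_assoc, hr]
      simp
    have : Mono (F.map f ≫ F.map r ≫ δ F P X) := h ▸ inferInstance
    exact mono_of_mono _ (F.map r ≫ δ F P X)

lemma exactFunctor_of_faithful [F.Faithful] [F.Additive]
    (hD : ∀ f : 𝟙_ D ⟶ 𝟙_ D, f ≠ 0 → IsIso f) (hC : ¬ IsZero (𝟙_ C)) :
    exactFunctor C D F := by
  have := preservesEpimorphisms_of_faithful F hD hC
  have := preservesMonomorphisms_of_faithful F hD hC
  refine ((Functor.exact_tfae F).out 0 3).1 fun S hS ↦ ?_
  have := hS.mono_f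
  have := hS.epi_g
  obtain ⟨P, p, s, _, hs⟩ := exists_epi_unit_lift S.g
  have := epi_map_comp_η_of_faithful F hD hC p
  -- Both terms of the difference agree after `S.g`, so it lifts through `S.f`; `F` then carries
  -- this relation to the hypothesis needed for descent.
  obtain ⟨t, ht⟩ : ∃ t : P ⊗ S.X₂ ⟶ S.X₁, t ≫ S.f = P ◁ S.g ≫ s - p ▷ S.X₂ ≫ (λ_ _).hom :=
    ⟨hS.exact.lift _ (by simp [hs, whisker_exchange_assoc]), hS.exact.lift_f _ _⟩
  have key {Z : D} (g : F.obj S.X₂ ⟶ Z) (hg : F.map S.f ≫ g = 0) :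
      ∃ g', F.map S.g ≫ g' = g := by
    refine exists_fac_of_epi_unit (F.map p ≫ η F) (F.map S.g) g (μ F _ _ ≫ F.map s ≫ g) ?_
    have h : (μ F _ _ ≫ F.map t) ≫ F.map S.f ≫ g = 0 := by rw [hg, comp_zero]
    rw [Category.assoc, ← F.map_comp_assoc, ht, Functor.map_sub, Preadditive.sub_comp,
      Preadditive.comp_sub, sub_eq_zero] at h
    simpa using h
  have : Epi (S.map F).g := inferInstanceAs (Epi (F.map S.g))
  have : Mono (S.map F).f := inferInstanceAs (Mono (F.map S.f))
  exact
    { exact := ShortComplex.exact_of_g_is_cokernel _ (CokernelCofork.IsColimit.ofπ _ _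
        (fun g hg ↦ (key g hg).choose) (fun g hg ↦ (key g hg).choose_spec)
        fun g hg m hm ↦ (cancel_epi (F.map S.g)).1 (hm.trans (key g hg).choose_spec.symm)) }

end

section

variable {C : Type u₁} [Category.{v₁} C] [Abelian C] [MonoidalCategory C] [MonoidalPreadditive C]
  [LeftRigidCategory C] [RightRigidCategory C]
  {D : Type u₂} [Category.{v₂} D] [Abelian D] [MonoidalCategory D] [MonoidalPreadditive D]
  (F : C ⥤ D) [F.Monoidal]

lemma faithful_of_exactFunctor [F.Additive] (hC : ∀ f : 𝟙_ C ⟶ 𝟙_ C, f ≠ 0 → IsIso f)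
    (hD : ¬ IsZero (𝟙_ D)) (hF : exactFunctor C D F) : F.Faithful := by
  obtain ⟨_, _⟩ : PreservesFiniteLimits F ∧ PreservesFiniteColimits F := hF
  have key {X : C} (hX : IsZero (F.obj X)) : IsZero X := by
    refine isZero_of_evaluation_eq_zero X (Xᘁ) ?_
    by_contra h
    have := epi_of_ne_zero_unit hC _ h
    have h₁ : IsZero (F.obj (Xᘁ ⊗ X)) :=
      (isZero_tensor_of_isZero_right _ hX).of_iso (Functor.Monoidal.μIso F _ _).symm
    have h₂ : IsZero (F.obj (𝟙_ C)) := IsZero.of_epi (F.map (ε_ X (Xᘁ))) h₁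
    exact hD (h₂.of_iso (Functor.Monoidal.εIso F))
  refine ⟨fun {X Y} f g hfg ↦ ?_⟩
  -- Exactness keeps the epi-mono factorization of `f - g`, so `F` kills its image.
  have h : F.map (Abelian.factorThruImage (f - g)) ≫ F.map (Abelian.image.ι (f - g)) = 0 := by
    rw [← F.map_comp, Abelian.image.fac, F.map_sub, hfg, sub_self]
  rw [← comp_zero (f := F.map _), cancel_epi] at h
  have h' := (key (IsZero.of_mono_eq_zero _ h)).eq_of_src (Abelian.image.ι (f - g)) 0
  rw [← sub_eq_zero, ← Abelian.image.fac (f - g), h', comp_zero]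

end

end Functor

/-! ### Consequences of the pseudo-tensor axioms -/

namespace IsPseudoTensorCategory

variable (k : Type w) [Field k] (D : Type u₁) [Category.{v₁} D] [Preadditive D] [Linear k D]
  [MonoidalCategory D] [MonoidalPreadditive D] [MonoidalLinear k D]

lemma isIso_of_ne_zero [IsPseudoTensorCategory k D] (f : 𝟙_ D ⟶ 𝟙_ D) (hf : f ≠ 0) : IsIso f := by
  obtain ⟨c, rfl⟩ := (bijective_algebraMap_end_unit (k := k) (D := D)).2 f
  have hc : c ≠ 0 := fun h ↦ hf (by rw [h, map_zero])
  exact (isUnit_iff_isIso _).1 ((isUnit_iff_ne_zero.2 hc).map (algebraMap k (End (𝟙_ D))))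

lemma not_isZero_unit [IsPseudoTensorCategory k D] : ¬ IsZero (𝟙_ D) := fun h ↦
  one_ne_zero ((bijective_algebraMap_end_unit (k := k) (D := D)).1 (h.eq_of_src _ _))

lemma nonempty_leftRigidCategory [IsPseudoTensorCategory k D] : Nonempty (LeftRigidCategory D) :=
  ⟨{ leftDual := fun X ↦ (nonempty_hasLeftDual k X).some }⟩

lemma nonempty_rightRigidCategory [IsPseudoTensorCategory k D] : Nonempty (RightRigidCategory D) :=
  ⟨{ rightDual := fun X ↦ (nonempty_hasRightDual k X).some }⟩

end IsPseudoTensorCategory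

open IsPseudoTensorCategory in
/-- A linear monoidal functor between tensor categories is faithful if and only if it is exact. -/
theorem faithful_iff_exactFunctor (k : Type w) [Field k]
    (T₁ : Type u₁) [Category.{v₁} T₁] [Abelian T₁] [Linear k T₁] [MonoidalCategory T₁]
    [MonoidalPreadditive T₁] [MonoidalLinear k T₁] [IsTensorCategory k T₁]
    (T₂ : Type u₂) [Category.{v₂} T₂] [Abelian T₂] [Linear k T₂] [MonoidalCategory T₂]
    [MonoidalPreadditive T₂] [MonoidalLinear k T₂] [IsTensorCategory k T₂]
    (F : T₁ ⥤ T₂) [F.Monoidal] [F.Additive] : F.Faithful ↔ exactFunctor T₁ T₂ F := by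
  obtain ⟨_⟩ := nonempty_leftRigidCategory k T₁
  obtain ⟨_⟩ := nonempty_rightRigidCategory k T₁
  obtain ⟨_⟩ := nonempty_leftRigidCategory k T₂
  obtain ⟨_⟩ := nonempty_rightRigidCategory k T₂
  exact ⟨fun _ ↦ exactFunctor_of_faithful F (isIso_of_ne_zero k T₂) (not_isZero_unit k T₁),
    faithful_of_exactFunctor F (isIso_of_ne_zero k T₁) (not_isZero_unit k T₂)⟩

/-! ### The identity functor as an abelian envelope -/

namespace LinearMonoidalFunctor

variable {k : Type w} [Field k]
  {C : Type u₁} [Category.{v₁} C] [Preadditive C] [Linear k C] [MonoidalCategory C]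
  {D : Type u₂} [Category.{v₂} D] [Preadditive D] [Linear k D] [MonoidalCategory D]

/-- An isomorphism of linear monoidal functors from a monoidal natural isomorphism. -/
def isoMk {G H : LinearMonoidalFunctor k C D} (e : G.functor ≅ H.functor)
    [NatTrans.IsMonoidal e.hom] : G ≅ H where
  hom := ⟨e.hom, inferInstance⟩
  inv := ⟨e.inv, inferInstance⟩
  hom_inv_id := Hom.ext e.hom_inv_id
  inv_hom_id := Hom.ext e.inv_hom_id

/-- Precomposition with the identity functor is isomorphic to the identity. -/
def precompId : precomp (k := k) (E := D) (𝟭 C) ≅ 𝟭 (LinearMonoidalFunctor k C D) :=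
  NatIso.ofComponents (fun G ↦
    have : NatTrans.IsMonoidal (F₁ := ((precomp (k := k) (E := D) (𝟭 C)).obj G).functor)
        G.functor.leftUnitor.hom :=
      inferInstanceAs (NatTrans.IsMonoidal (F₁ := 𝟭 C ⋙ G.functor) G.functor.leftUnitor.hom)
    isoMk (G := (precomp (𝟭 C)).obj G) (H := G) G.functor.leftUnitor) fun α ↦ Hom.ext <| by
    ext X
    exact (Category.comp_id _).trans (Category.id_comp _).symm

instance : (precomp (k := k) (E := D) (𝟭 C)).IsEquivalence :=
  Functor.isEquivalence_of_iso precompId.symm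

end LinearMonoidalFunctor

theorem isAbelianEnvelope_id (k : Type w) [Field k]
    (T : Type u₁) [Category.{v₁} T] [Abelian T] [Linear k T] [MonoidalCategory T]
    [MonoidalPreadditive T] [MonoidalLinear k T] [IsTensorCategory k T] :
    IsAbelianEnvelope.{w, v₁, v₁, v₂, u₁, u₁, u₂} k (𝟭 T) where
  full := inferInstance
  faithful := inferInstance
  equivalence T₁ _ _ _ _ _ _ _ := by
    refine ⟨fun G ↦ (faithful_iff_exactFunctor k T T₁ G.obj.functor).2 G.property, ?_⟩
    let G := (LinearMonoidalFunctor.isExact k T T₁).ι ⋙ LinearMonoidalFunctor.precomp (𝟭 T)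
    exact
      -- Followed by the fully faithful inclusion, the lift becomes `G`, itself fully faithful as
      -- the inclusion of exact functors followed by an equivalence.
      { faithful := Functor.Faithful.of_comp_iso (ObjectProperty.liftCompιIso _ G _)
        full := Functor.Full.of_comp_faithful_iso (ObjectProperty.liftCompιIso _ G _)
        essSurj := ⟨fun G ↦ ⟨⟨G.obj, (faithful_iff_exactFunctor k T T₁ G.obj.functor).1 G.property⟩,
          ⟨ObjectProperty.isoMk _ (LinearMonoidalFunctor.precompId.app G.obj)⟩⟩⟩ }

theorem mainTheorem5 (k : Type w) [Field k] :
    (∀ (T₁ : Type u₁) [Category.{v₁} T₁] [Abelian T₁] [Linear k T₁] [MonoidalCategory T₁]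
        [MonoidalPreadditive T₁] [MonoidalLinear k T₁] [IsTensorCategory k T₁]
        (T₂ : Type u₂) [Category.{v₂} T₂] [Abelian T₂] [Linear k T₂] [MonoidalCategory T₂]
        [MonoidalPreadditive T₂] [MonoidalLinear k T₂] [IsTensorCategory k T₂]
        (F : T₁ ⥤ T₂) [F.Monoidal] [F.Additive] [F.Linear k],
        F.Faithful ↔ exactFunctor T₁ T₂ F) ∧
    (∀ (T : Type u₁) [Category.{v₁} T] [Abelian T] [Linear k T] [MonoidalCategory T]
        [MonoidalPreadditive T] [MonoidalLinear k T] [IsTensorCategory k T],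
        IsAbelianEnvelope.{w, v₁, v₁, v₂, u₁, u₁, u₂} k (𝟭 T)) :=
  ⟨fun T₁ _ _ _ _ _ _ _ T₂ _ _ _ _ _ _ _ F _ _ _ ↦ faithful_iff_exactFunctor k T₁ T₂ F,
    fun T _ _ _ _ _ _ _ ↦ isAbelianEnvelope_id k T⟩
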